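/- Let $\mathcal U\subset\mathbb R^n$ be open, let $f:\mathbb R\to\mathbb R$ be nonnegative, nondecreasing and of class $C^1$, and let $u\in W^{1,2}_{\rm loc}(\mathcal U)$ be a weak solution of $-\Delta u=f(u)$ in $\mathcal U$, that is, $f(u)\in L^1_{\rm loc}(\mathcal U)$ and $$\int_{\mathcal U}\nabla u\cdot\nabla\varphi\,dx=\int_{\mathcal U}f(u)\,\varphi\,dx\qquad\forall\,\varphi\in C^1_c(\mathcal U).$$ For an open set $\mathcal V\subset\mathcal U$ and $j\in\mathbb N=\{0,1,2,\dots\}$, write ${\rm ind}(u,\mathcal V)=j$ if $f'(u)\in L^1_{\rm loc}(\mathcal V)$ and $j$ is the maximal dimension of a linear subspace $X\subset C^1_c(\mathcal V)$ such that $$\int_{\mathcal V}\left(|\nabla\xi|^2-f'(u)\xi^2\right)dx<0\qquad\forall\,\xi\in X\setminus\{0\};$$ $u$ is called stable in $\mathcal V$ if ${\rm ind}(u,\mathcal V)=0$. Let $k\in\mathbb N$ and assume that ${\rm ind}(u,\mathcal U)\le k$ (in particular, that the index is finite). Then: (i) If $\mathcal U_1,\dots,\mathcal U_{k+1}$ are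 pairwise disjoint open subsets of $\mathcal U$, then $u$ is stable in at least one of the sets $\mathcal U_i$. (ii) If $n\ge2$, then there is a constant $C_n>0$ depending only on $n$ such that, for every $\bar x\in\mathbb R^n$ and $r>0$ with $B_{2r}(\bar x)\subset\mathcal U$, the function $f'(u)$ is integrable on $B_r(\bar x)$ and $$\int_{B_r(\bar x)}f'(u)\,dx\le C_n\,(1+k)^{2/n}\,r^{n-2}.$$ -/

import Mathlib

open MeasureTheory
open scoped Gradient ContDiff

namespace Morse

/-- `φ` is a function of class `C^m` on `ℝⁿ` whose support is a compact subset of `U`;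
that is, `φ ∈ C^m_c(U)`, extended by zero outside `U`. -/
def IsCc {n : ℕ} (m : WithTop ℕ∞) (U : Set (EuclideanSpace ℝ (Fin n)))
    (φ : EuclideanSpace ℝ (Fin n) → ℝ) : Prop :=
  ContDiff ℝ m φ ∧ HasCompactSupport φ ∧ tsupport φ ⊆ U

/-- `g ∈ L²_loc(U)`: square integrable on every compact subset of `U`. -/
def MemL2Loc {n : ℕ} {F : Type*} [NormedAddCommGroup F]
    (g : EuclideanSpace ℝ (Fin n) → F) (U : Set (EuclideanSpace ℝ (Fin n))) : Prop :=
  ∀ K : Set (EuclideanSpace ℝ (Fin n)), K ⊆ U → IsCompact K → MemLp g 2 (volume.restrict K)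

/-- `u ∈ W^{1,2}_loc(U)`, and `G` is its distributional gradient in `U`. -/
structure HasW12LocGradient {n : ℕ} (u : EuclideanSpace ℝ (Fin n) → ℝ)
    (G : EuclideanSpace ℝ (Fin n) → EuclideanSpace ℝ (Fin n))
    (U : Set (EuclideanSpace ℝ (Fin n))) : Prop where
  memL2Loc : MemL2Loc u U
  memL2Loc_grad : MemL2Loc G U
  integral_by_parts : ∀ φ : EuclideanSpace ℝ (Fin n) → ℝ, IsCc ∞ U φ →
    ∀ i : Fin n, ∫ x in U, u x * (∇ φ x) i = - ∫ x in U, (G x) i * φ x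

/-- `u ∈ W^{1,2}_loc(U)` is a weak solution of `-Δu = f(u)` in `U`. The weak gradient `G` is
unique almost everywhere in `U`, so the existential quantifier is harmless. -/
def IsWeakSolution {n : ℕ} (f : ℝ → ℝ) (u : EuclideanSpace ℝ (Fin n) → ℝ)
    (U : Set (EuclideanSpace ℝ (Fin n))) : Prop :=
  LocallyIntegrableOn (fun x => f (u x)) U ∧
  ∃ G : EuclideanSpace ℝ (Fin n) → EuclideanSpace ℝ (Fin n),
    HasW12LocGradient u G U ∧
    ∀ φ : EuclideanSpace ℝ (Fin n) → ℝ, IsCc 1 U φ →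
      ∫ x in U, inner ℝ (G x) (∇ φ x) = ∫ x in U, f (u x) * φ x

/-- The quadratic form `Q_u(ξ) = ∫_U (|∇ξ|² - f'(u) ξ²) dx`. -/
noncomputable def Q {n : ℕ} (f : ℝ → ℝ) (u : EuclideanSpace ℝ (Fin n) → ℝ)
    (U : Set (EuclideanSpace ℝ (Fin n))) (ξ : EuclideanSpace ℝ (Fin n) → ℝ) : ℝ :=
  ∫ x in U, (‖∇ ξ x‖ ^ 2 - deriv f (u x) * ξ x ^ 2)

/-- `X` is a linear subspace of `C¹_c(U)` on which `Q_u` is negative definite. -/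
def IsNegativeSubspace {n : ℕ} (f : ℝ → ℝ) (u : EuclideanSpace ℝ (Fin n) → ℝ)
    (U : Set (EuclideanSpace ℝ (Fin n)))
    (X : Submodule ℝ (EuclideanSpace ℝ (Fin n) → ℝ)) : Prop :=
  (∀ ξ ∈ X, IsCc 1 U ξ) ∧ ∀ ξ ∈ X, ξ ≠ 0 → Q f u U ξ < 0

/-- `ind(u, U) = k`: `f'(u) ∈ L¹_loc(U)` and `k` is the maximal dimension of a subspace of
`C¹_c(U)` on which `Q_u` is negative definite. (An infinite-dimensional such subspace has
subspaces of every finite dimension, so that then no maximum exists.) -/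
def HasMorseIndex {n : ℕ} (f : ℝ → ℝ) (u : EuclideanSpace ℝ (Fin n) → ℝ)
    (U : Set (EuclideanSpace ℝ (Fin n))) (k : ℕ) : Prop :=
  LocallyIntegrableOn (fun x => deriv f (u x)) U ∧
  IsGreatest {d : ℕ | ∃ X : Submodule ℝ (EuclideanSpace ℝ (Fin n) → ℝ),
    IsNegativeSubspace f u U X ∧ FiniteDimensional ℝ X ∧ Module.finrank ℝ X = d} k

/-- `ind(u, U) ≤ k`: the Morse index of `u` in `U` is finite, and at most `k`. -/
def MorseIndexLE {n : ℕ} (f : ℝ → ℝ) (u : EuclideanSpace ℝ (Fin n) → ℝ)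
    (U : Set (EuclideanSpace ℝ (Fin n))) (k : ℕ) : Prop :=
  ∃ j ≤ k, HasMorseIndex f u U j

/-- `u` is stable in `U`: its Morse index in `U` is zero. -/
def IsStable {n : ℕ} (f : ℝ → ℝ) (u : EuclideanSpace ℝ (Fin n) → ℝ)
    (U : Set (EuclideanSpace ℝ (Fin n))) : Prop :=
  HasMorseIndex f u U 0

end Morse

namespace Morse

/-! Test functions with disjoint supports are orthogonal for the quadratic form `Q`, so `k + 1` of
them with `Q < 0` would span a negative subspace of dimension `k + 1`. Hence index at most `k`
forbids this (`MorseIndexLE.not_forall_Q_neg`). Part (i) follows at once: instability in every one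
of the disjoint sets would supply such functions.

For (ii), let `ν` be the measure `f'(u) dx` on `B_r`, of total mass `M`. The core is a decomposition
in the style of Grigor'yan, Netrusov and Yau (`exists_capacitors`): for every `N` there are `N`
disjointly supported cutoffs, each equal to 1 on a set of `ν`-mass at least `M / (K N)`, with total
Dirichlet energy at most `K (s² r^n + s^(2-n) N)` for any chosen `s > 0`, where `K` depends only on
`n`. With `N = 2(k + 1)`, at least `k + 1` of them have `Q ≥ 0`, so for these the mass seen is
bounded by the energy. Summing over them and taking `s = (1 + k)^(1/n) / r` gives the estimate.

The cutoffs sit on balls chosen greedily at the finest scale `r / 4^(p+1)` still carrying mass `m ~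
M / N` outside the earlier dilated balls. Each cutoff must also vanish near the earlier balls. A
single one may have to avoid many of them, but the "active" ones number `O(N)` altogether
(`sum_card_activeIndices_le`). Each active ball contributes a bounded amount to the scale-invariant
`n`-energy, and the passage to exponent 2 is `sq_le_add_mul_pow`. -/

lemma norm_gradient_eq {n : ℕ} (φ : EuclideanSpace ℝ (Fin n) → ℝ) (x : EuclideanSpace ℝ (Fin n)) :
    ‖∇ φ x‖ = ‖fderiv ℝ φ x‖ := by
  simp [gradient]

/-! ### Test functions and integrability of the quadratic form. -/

namespace IsCc

variable {n : ℕ} {U V : Set (EuclideanSpace ℝ (Fin n))} {φ ψ : EuclideanSpace ℝ (Fin n) → ℝ}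

lemma mono (h : IsCc 1 V φ) (hVU : V ⊆ U) : IsCc 1 U φ :=
  ⟨h.1, h.2.1, h.2.2.trans hVU⟩

lemma zero : IsCc 1 U (0 : EuclideanSpace ℝ (Fin n) → ℝ) :=
  ⟨contDiff_const, HasCompactSupport.zero, by simp [tsupport]⟩

lemma const_smul (h : IsCc 1 U φ) (c : ℝ) : IsCc 1 U (c • φ) := by
  refine ⟨h.1.const_smul c, h.2.1.smul_left (f := fun _ => c), ?_⟩
  exact (tsupport_smul_subset_right (fun _ => c) φ).trans h.2.2

lemma add (h : IsCc 1 U φ) (h' : IsCc 1 U ψ) : IsCc 1 U (φ + ψ) :=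
  ⟨h.1.add h'.1, h.2.1.add h'.2.1, (tsupport_add φ ψ).trans (Set.union_subset h.2.2 h'.2.2)⟩

lemma sum {ι : Type*} (s : Finset ι) {φ : ι → EuclideanSpace ℝ (Fin n) → ℝ}
    (h : ∀ i, IsCc 1 U (φ i)) : IsCc 1 U (∑ i ∈ s, φ i) := by
  classical
  induction s using Finset.induction_on with
  | empty => simpa using zero
  | insert a s ha ih => rw [Finset.sum_insert ha]; exact (h a).add ih

lemma integrable_norm_gradient_sq (h : IsCc 1 U φ) : Integrable (fun x => ‖∇ φ x‖ ^ 2) := by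
  simp only [norm_gradient_eq]
  have hc : Continuous (fun x => fderiv ℝ φ x) := h.1.continuous_fderiv one_ne_zero
  refine (hc.norm.pow 2).integrable_of_hasCompactSupport (HasCompactSupport.intro h.2.1 ?_)
  intro x hx
  have h0 : fderiv ℝ φ x = 0 := by
    by_contra h
    exact hx (support_fderiv_subset ℝ h)
  change ‖fderiv ℝ φ x‖ ^ 2 = 0
  rw [h0, norm_zero, zero_pow two_ne_zero]

lemma integrable_mul_sq {w : EuclideanSpace ℝ (Fin n) → ℝ} (hw : LocallyIntegrableOn w U)
    (h : IsCc 1 U φ) : Integrable (fun x => w x * φ x ^ 2) := by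
  have hK : IntegrableOn w (tsupport φ) := hw.integrableOn_compact_subset h.2.2 h.2.1
  have h2 : IntegrableOn (fun x => w x * φ x ^ 2) (tsupport φ) :=
    hK.mul_continuousOn (h.1.continuous.pow 2).continuousOn h.2.1
  refine (integrableOn_iff_integrable_of_support_subset ?_).1 h2
  intro x hx
  refine subset_tsupport _ ?_
  intro h0
  simp [h0] at hx

lemma gradient_eq_zero (x : EuclideanSpace ℝ (Fin n)) (hx : x ∉ tsupport φ) : ∇ φ x = 0 := by
  have : fderiv ℝ φ x = 0 := by
    by_contra h
    exact hx (support_fderiv_subset ℝ h)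
  simp [gradient, this]

lemma setIntegral_Q_eq {f : ℝ → ℝ} {u : EuclideanSpace ℝ (Fin n) → ℝ} (h : IsCc 1 U φ) :
    Q f u U φ = ∫ x, (‖∇ φ x‖ ^ 2 - deriv f (u x) * φ x ^ 2) := by
  refine setIntegral_eq_integral_of_forall_compl_eq_zero fun x hx => ?_
  have hx' : x ∉ tsupport φ := fun h' => hx (h.2.2 h')
  simp [gradient_eq_zero x hx', image_eq_zero_of_notMem_tsupport hx']

end IsCc

/-! ### Morse index and disjointly supported test functions; part (i). -/

section Index

variable {n : ℕ} {U : Set (EuclideanSpace ℝ (Fin n))} {f : ℝ → ℝ}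
  {u : EuclideanSpace ℝ (Fin n) → ℝ}

lemma Q_zero : Q f u U 0 = 0 := by
  have : ∀ x : EuclideanSpace ℝ (Fin n),
      ∇ (0 : EuclideanSpace ℝ (Fin n) → ℝ) x = 0 := fun x =>
    IsCc.gradient_eq_zero x (by simp [tsupport])
  simp [Q, this]

lemma Q_sum_smul {ι : Type*} [Fintype ι] (hf : LocallyIntegrableOn (fun x => deriv f (u x)) U)
    {ξ : ι → EuclideanSpace ℝ (Fin n) → ℝ} (hc : ∀ i, IsCc 1 U (ξ i))
    (hdisj : ∀ i j, i ≠ j → Disjoint (tsupport (ξ i)) (tsupport (ξ j))) (c : ι → ℝ) :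
    Q f u U (∑ i, c i • ξ i) = ∑ i, c i ^ 2 * Q f u U (ξ i) := by
  classical
  have hs : IsCc 1 U (∑ i, c i • ξ i) := IsCc.sum _ fun i => (hc i).const_smul (c i)
  rw [hs.setIntegral_Q_eq]
  simp_rw [fun i => (hc i).setIntegral_Q_eq (f := f) (u := u), ← integral_const_mul]
  rw [← integral_finsetSum]
  · refine integral_congr_ae (Filter.Eventually.of_forall fun x => ?_)
    have hd : ∀ i, DifferentiableAt ℝ (ξ i) x := fun i =>
      (hc i).1.differentiable one_ne_zero x
    have hD : fderiv ℝ (∑ i, c i • ξ i) x = ∑ i, c i • fderiv ℝ (ξ i) x := by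
      rw [fderiv_sum fun i _ => (hd i).const_smul (c i)]
      exact Finset.sum_congr rfl fun i _ => fderiv_const_smul (hd i) (c i)
    simp only [norm_gradient_eq, hD, Finset.sum_apply, Pi.smul_apply]
    -- At each point at most one `ξ i` and its derivative survive, so all cross terms vanish
    -- pointwise.
    by_cases hx : ∃ i, x ∈ tsupport (ξ i)
    · obtain ⟨i, hi⟩ := hx
      have hj : ∀ j, j ≠ i → x ∉ tsupport (ξ j) := fun j hji hx' =>
        Set.disjoint_left.1 (hdisj j i hji) hx' hi
      have h0 : ∀ j, j ≠ i → ξ j x = 0 := fun j h => image_eq_zero_of_notMem_tsupport (hj j h)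
      have h1 : ∀ j, j ≠ i → fderiv ℝ (ξ j) x = 0 := fun j h => by
        by_contra h'
        exact hj j h (support_fderiv_subset ℝ h')
      rw [Finset.sum_eq_single i (fun j _ h => by simp [h1 j h]) (by simp),
        Finset.sum_eq_single i (fun j _ h => by simp [h0 j h]) (by simp),
        Finset.sum_eq_single i (fun j _ h => by simp [h0 j h, h1 j h]) (by simp)]
      rw [norm_smul, mul_pow, Real.norm_eq_abs, sq_abs, smul_eq_mul]
      ring
    · push Not at hx
      have h0 : ∀ j, ξ j x = 0 := fun j => image_eq_zero_of_notMem_tsupport (hx j)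
      have h1 : ∀ j, fderiv ℝ (ξ j) x = 0 := fun j => by
        by_contra h'
        exact hx j (support_fderiv_subset ℝ h')
      simp [h0, h1]
  · exact fun i _ => ((hc i).integrable_norm_gradient_sq.sub
      ((hc i).integrable_mul_sq hf)).const_mul _

/-- If the Morse index is at most `k`, then `Q` cannot be negative on `k + 1` test functions with
disjoint supports. -/
lemma MorseIndexLE.not_forall_Q_neg {k : ℕ} (hI : MorseIndexLE f u U k)
    {ξ : Fin (k + 1) → EuclideanSpace ℝ (Fin n) → ℝ} (hc : ∀ i, IsCc 1 U (ξ i))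
    (hdisj : ∀ i j, i ≠ j → Disjoint (tsupport (ξ i)) (tsupport (ξ j))) :
    ¬ ∀ i, Q f u U (ξ i) < 0 := by
  classical
  intro hneg
  obtain ⟨j, hjk, hf, hj⟩ := hI
  have hli : LinearIndependent ℝ ξ := by
    rw [Fintype.linearIndependent_iff]
    intro c hc0 i
    have hne : ξ i ≠ 0 := fun h => by
      have := hneg i
      rw [h, Q_zero] at this
      exact lt_irrefl _ this
    obtain ⟨y, hy⟩ := Function.ne_iff.1 hne
    have := congrFun hc0 y
    simp only [Finset.sum_apply, Pi.smul_apply, smul_eq_mul, Pi.zero_apply] at this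
    rw [Finset.sum_eq_single i (fun l _ hl => ?_) (by simp)] at this
    · exact (mul_eq_zero.1 this).resolve_right hy
    · rw [image_eq_zero_of_notMem_tsupport fun hx => Set.disjoint_left.1 (hdisj l i hl) hx
        (subset_tsupport _ hy), mul_zero]
  have hmem : k + 1 ∈ {d : ℕ | ∃ X : Submodule ℝ (EuclideanSpace ℝ (Fin n) → ℝ),
      IsNegativeSubspace f u U X ∧ FiniteDimensional ℝ X ∧ Module.finrank ℝ X = d} := by
    refine ⟨Submodule.span ℝ (Set.range ξ), ⟨?_, ?_⟩,
      FiniteDimensional.span_of_finite ℝ (Set.finite_range ξ), ?_⟩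
    · intro φ hφ
      obtain ⟨c, rfl⟩ := (Submodule.mem_span_range_iff_exists_fun ℝ).1 hφ
      exact IsCc.sum _ fun i => (hc i).const_smul (c i)
    · intro φ hφ hne
      obtain ⟨c, rfl⟩ := (Submodule.mem_span_range_iff_exists_fun ℝ).1 hφ
      rw [Q_sum_smul hf hc hdisj]
      have hci : ∃ i, c i ≠ 0 := by
        by_contra! h
        exact hne (by simp [h])
      obtain ⟨i, hi⟩ := hci
      refine Finset.sum_neg' (fun l _ => ?_) ⟨i, Finset.mem_univ i, ?_⟩
      · exact mul_nonpos_of_nonneg_of_nonpos (sq_nonneg _) (hneg l).le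
      · exact mul_neg_of_pos_of_neg (by positivity) (hneg i)
    · rw [finrank_span_eq_card hli, Fintype.card_fin]
  have := hj.2 hmem
  omega

lemma exists_Q_neg_of_not_isStable (hf : LocallyIntegrableOn (fun x => deriv f (u x)) U)
    (h : ¬ IsStable f u U) : ∃ ξ, IsCc 1 U ξ ∧ Q f u U ξ < 0 := by
  by_contra! hcon
  refine h ⟨hf, ⟨⊥, ⟨?_, ?_⟩, inferInstance, by simp⟩, ?_⟩
  · intro ξ hξ
    rw [(Submodule.mem_bot ℝ).1 hξ]
    exact IsCc.zero
  · intro ξ hξ hne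
    exact (hne ((Submodule.mem_bot ℝ).1 hξ)).elim
  · rintro d ⟨X, ⟨hX1, hX2⟩, hfin, rfl⟩
    have : X = ⊥ := by
      rw [Submodule.eq_bot_iff]
      intro ξ hξ
      by_contra hne
      exact absurd (hX2 ξ hξ hne) (not_lt.2 (hcon ξ (hX1 ξ hξ)))
    subst this
    simp

/-- Among `k + 1` disjoint open sets, a solution of Morse index at most `k` is stable in one. -/
lemma MorseIndexLE.exists_isStable {k : ℕ} (hI : MorseIndexLE f u U k)
    {V : Fin (k + 1) → Set (EuclideanSpace ℝ (Fin n))} (hVU : ∀ i, V i ⊆ U)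
    (hdisj : ∀ i j, i ≠ j → Disjoint (V i) (V j)) : ∃ i, IsStable f u (V i) := by
  by_contra! hcon
  obtain ⟨_, _, hf, _⟩ := id hI
  choose ξ hξ hneg using fun i => exists_Q_neg_of_not_isStable (hf.mono_set (hVU i)) (hcon i)
  refine hI.not_forall_Q_neg (fun i => (hξ i).mono (hVU i))
    (fun i j hij => (hdisj i j hij).mono (hξ i).2.2 (hξ j).2.2) fun i => ?_
  -- The form does not see the domain: over `U` and over `V i` it equals the integral over the whole
  -- space.
  rw [((hξ i).mono (hVU i)).setIntegral_Q_eq, ← (hξ i).setIntegral_Q_eq]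
  exact hneg i

end Index

/-! ### Covering balls by smaller balls. -/

section Cover

/-- The cardinality of `T` serves as the doubling constant. Radius `14 = 12 + 2` suffices both for
the 12-fold dilations and for the packing count of active balls; `1 / 4` is the ratio of consecutive
scales. -/
lemma exists_finset_cover_closedBall (E : Type*) [NormedAddCommGroup E] [ProperSpace E] :
    ∃ T : Finset E, T.Nonempty ∧
      Metric.closedBall (0 : E) 14 ⊆ ⋃ t ∈ T, Metric.ball t (1 / 4) := by
  obtain ⟨T, -, hT⟩ := (isCompact_closedBall (0 : E) 14).elim_nhds_subcover
    (fun t => Metric.ball t (1 / 4)) (fun t _ => Metric.ball_mem_nhds t (by norm_num))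
  refine ⟨T, ?_, hT⟩
  have := hT (Metric.mem_closedBall_self (by norm_num))
  simp only [Set.mem_iUnion] at this
  obtain ⟨t, ht, -⟩ := this
  exact ⟨t, ht⟩

variable {E : Type*} [NormedAddCommGroup E] [NormedSpace ℝ E]

lemma ball_subset_iUnion_ball {T : Finset E}
    (hT : Metric.closedBall (0 : E) 14 ⊆ ⋃ t ∈ T, Metric.ball t (1 / 4)) (x : E) {ρ R : ℝ}
    (hρ : 0 < ρ) (hR : R ≤ 14 * ρ) :
    Metric.ball x R ⊆ ⋃ t ∈ T, Metric.ball (x + ρ • t) (ρ / 4) := by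
  intro y hy
  have h1 : ρ⁻¹ • (y - x) ∈ Metric.closedBall (0 : E) 14 := by
    rw [mem_closedBall_zero_iff, norm_smul, norm_inv, Real.norm_of_nonneg hρ.le,
      inv_mul_le_iff₀ hρ, ← dist_eq_norm]
    have := Metric.mem_ball.1 hy
    linarith
  have h2 := hT h1
  simp only [Set.mem_iUnion] at h2 ⊢
  obtain ⟨t, ht, hyt⟩ := h2
  refine ⟨t, ht, ?_⟩
  rw [Metric.mem_ball, dist_eq_norm] at hyt ⊢
  have : y - (x + ρ • t) = ρ • (ρ⁻¹ • (y - x) - t) := by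
    rw [smul_sub, smul_inv_smul₀ hρ.ne']; abel
  rw [this, norm_smul, Real.norm_of_nonneg hρ.le]
  nlinarith

variable [MeasurableSpace E] {ν : Measure E} [IsFiniteMeasure ν]

/-- If every ball of the next finer scale is light outside `A`, then even a 12-fold dilation at the
current scale adds less than `T.card * m` to the mass of `A`. -/
lemma measureReal_ball_diff_lt {T : Finset E} (hne : T.Nonempty)
    (hT : Metric.closedBall (0 : E) 14 ⊆ ⋃ t ∈ T, Metric.ball t (1 / 4)) (x : E) {ρ R m : ℝ}
    (hρ : 0 < ρ) (hR : R ≤ 14 * ρ) (A : Set E)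
    (hm : ∀ y, ν.real (Metric.ball y (ρ / 4) \ A) < m) :
    ν.real (Metric.ball x R \ A) < T.card * m := by
  have h1 : Metric.ball x R \ A ⊆ ⋃ t ∈ T, (Metric.ball (x + ρ • t) (ρ / 4) \ A) := by
    rintro y ⟨hy, hyA⟩
    have := ball_subset_iUnion_ball hT x hρ hR hy
    simp only [Set.mem_iUnion] at this ⊢
    obtain ⟨t, ht, hyt⟩ := this
    exact ⟨t, ht, hyt, hyA⟩
  calc ν.real (Metric.ball x R \ A)
      ≤ ν.real (⋃ t ∈ T, (Metric.ball (x + ρ • t) (ρ / 4) \ A)) :=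
        measureReal_mono h1 (measure_ne_top ν _)
    _ ≤ ∑ t ∈ T, ν.real (Metric.ball (x + ρ • t) (ρ / 4) \ A) := measureReal_biUnion_finset_le _ _
    _ < ∑ t ∈ T, m := Finset.sum_lt_sum_of_nonempty hne fun t _ => hm _
    _ = T.card * m := by simp

end Cover

/-! ### Greedy choice of heavy balls. -/

section Greedy

variable {E : Type*} [NormedAddCommGroup E] [NormedSpace ℝ E] [MeasurableSpace E]
  {ν : Measure E} [IsFiniteMeasure ν]

/-- Outside a set `A` which does not carry too much mass, there is a ball of smallest radius
`r / 4 ^ (p + 1)` which carries mass at least `m`. -/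
lemma exists_smallest_heavy_ball {T : Finset E} (hne : T.Nonempty)
    (hT : Metric.closedBall (0 : E) 14 ⊆ ⋃ t ∈ T, Metric.ball t (1 / 4)) {x₀ : E} {r m : ℝ}
    (hr : 0 < r) (hm : 0 < m) (hν : ν (Metric.ball x₀ r)ᶜ = 0)
    (hsmall : ∀ ε > 0, ∃ δ > 0, ∀ y, ν.real (Metric.ball y δ) < ε) (A : Set E)
    (hA : T.card * m ≤ ν.real Aᶜ) :
    ∃ (x : E) (p : ℕ), m ≤ ν.real (Metric.ball x (r / 4 ^ (p + 1)) \ A) ∧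
      ∀ q > p, ∀ y, ν.real (Metric.ball y (r / 4 ^ (q + 1)) \ A) < m := by
  set S : Set ℕ := {p | ∃ x, m ≤ ν.real (Metric.ball x (r / 4 ^ (p + 1)) \ A)} with hS
  -- The coarsest scale `r / 4` qualifies: `T.card` such balls cover `B(x₀, r)`, which carries all
  -- the mass. The scales are bounded in `p` because tiny balls are uniformly light, so a finest one
  -- exists.
  have h0 : (0 : ℕ) ∈ S := by
    by_contra hcon
    simp only [hS, Set.mem_ofPred_eq, not_exists, not_le, zero_add, pow_one] at hcon
    have h1 := measureReal_ball_diff_lt (ν := ν) hne hT x₀ hr (R := r) (by linarith) A hcon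
    have h2 : ν.real Aᶜ ≤ ν.real (Metric.ball x₀ r \ A) + ν.real (Metric.ball x₀ r)ᶜ := by
      refine le_trans (measureReal_mono ?_) (measureReal_union_le _ _)
      intro y hy
      by_cases h : y ∈ Metric.ball x₀ r
      · exact Or.inl ⟨h, hy⟩
      · exact Or.inr h
    have h3 : ν.real (Metric.ball x₀ r)ᶜ = 0 := by simp [Measure.real, hν]
    linarith
  obtain ⟨δ, hδ, hδm⟩ := hsmall m hm
  obtain ⟨P, hP⟩ := exists_pow_lt_of_lt_one (div_pos hδ hr) (by norm_num : (1 / 4 : ℝ) < 1)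
  have hb : BddAbove S := by
    refine ⟨P, fun p hp => ?_⟩
    by_contra! hlt
    obtain ⟨x, hx⟩ := hp
    have hle : r / 4 ^ (p + 1) ≤ δ := by
      have h1 : (1 / 4 : ℝ) ^ (p + 1) ≤ (1 / 4) ^ P :=
        pow_le_pow_of_le_one (by norm_num) (by norm_num) (by omega)
      have h2 := (h1.trans hP.le)
      rw [le_div_iff₀ hr, one_div, inv_pow] at h2
      rw [div_eq_inv_mul]
      exact h2
    have := measureReal_mono (μ := ν) (Set.sdiff_subset.trans (Metric.ball_subset_ball hle) :
      Metric.ball x (r / 4 ^ (p + 1)) \ A ⊆ Metric.ball x δ)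
    linarith [hδm x]
  obtain ⟨x, hx⟩ := Nat.sSup_mem ⟨0, h0⟩ hb
  refine ⟨x, sSup S, hx, fun q hq y => ?_⟩
  by_contra! hcon
  exact absurd (le_csSup hb (⟨y, hcon⟩ : q ∈ S)) (not_le.2 hq)

/-- Greedy selection of `N` balls with nondecreasing radii, each carrying mass at least `m` outside
the twelvefold dilations of the preceding ones. -/
lemma exists_greedy_balls [OpensMeasurableSpace E] {T : Finset E} (hne : T.Nonempty)
    (hT : Metric.closedBall (0 : E) 14 ⊆ ⋃ t ∈ T, Metric.ball t (1 / 4)) {x₀ : E} {r m : ℝ}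
    (hr : 0 < r) (hm : 0 < m) (hν : ν (Metric.ball x₀ r)ᶜ = 0)
    (hsmall : ∀ ε > 0, ∃ δ > 0, ∀ y, ν.real (Metric.ball y δ) < ε) {N : ℕ}
    (hN : 2 * T.card * N * m ≤ ν.real Set.univ) :
    ∃ (x : ℕ → E) (ρ : ℕ → ℝ), (∀ i, 0 < ρ i ∧ ρ i ≤ r / 4) ∧
      (∀ i < N, m ≤ ν.real (Metric.ball (x i) (ρ i) \ ⋃ j < i, Metric.ball (x j) (12 * ρ j))) ∧
      (∀ i < N, ∀ j < i, ρ j ≤ ρ i) ∧ ∀ i < N, ∀ j < i, ρ j < ρ i → 4 * ρ j ≤ ρ i := by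
  have key : ∀ A : Set E, ∃ (x : E) (p : ℕ), T.card * m ≤ ν.real Aᶜ →
      m ≤ ν.real (Metric.ball x (r / 4 ^ (p + 1)) \ A) ∧
      ∀ q > p, ∀ y, ν.real (Metric.ball y (r / 4 ^ (q + 1)) \ A) < m := by
    intro A
    by_cases hA : T.card * m ≤ ν.real Aᶜ
    · obtain ⟨x, p, h⟩ := exists_smallest_heavy_ball hne hT hr hm hν hsmall A hA
      exact ⟨x, p, fun _ => h⟩
    -- Arbitrary values once too little mass is left; they are never reached for indices below `N`.
    · exact ⟨0, 0, fun h => absurd h hA⟩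
  choose X P hXP using key
  let B : Set E → Set E := fun A => Metric.ball (X A) (12 * (r / 4 ^ (P A + 1)))
  obtain ⟨A, hA0, hAs⟩ : ∃ A : ℕ → Set E, A 0 = ∅ ∧ ∀ i, A (i + 1) = A i ∪ B (A i) :=
    ⟨fun i => Nat.rec ∅ (fun _ A => A ∪ B A) i, rfl, fun _ => rfl⟩
  have hAmono : Monotone A := monotone_nat_of_le_succ fun i => by
    rw [hAs]; exact Set.subset_union_left
  have hAm : ∀ i, MeasurableSet (A i) := by
    intro i
    induction i with
    | zero => rw [hA0]; exact MeasurableSet.empty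
    | succ i ih => rw [hAs]; exact ih.union Metric.isOpen_ball.measurableSet
  have hAU : ∀ i, A i = ⋃ j < i, B (A j) := by
    intro i
    induction i with
    | zero => simp [hA0]
    | succ i ih =>
      rw [hAs, Set.biUnion_lt_succ (fun j => B (A j)) i, ← ih]
  have hrp : ∀ p : ℕ, 0 < r / 4 ^ (p + 1) := fun p => by positivity
  have hstep : ∀ p : ℕ, r / 4 ^ (p + 1) / 4 = r / 4 ^ (p + 1 + 1) := fun p => by
    rw [pow_succ _ (p + 1), div_div]
  -- The factor 2 in `hN` leaves mass at least `(2N - i) * T.card * m`, enough for another step.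
  have hcompl : ∀ i, i < N → ν.real (A i) ≤ i * (T.card * m) →
      T.card * m ≤ ν.real (A i)ᶜ := by
    intro i hi h
    rw [measureReal_compl (hAm i)]
    have hC : 0 ≤ (T.card : ℝ) * m := mul_nonneg (Nat.cast_nonneg _) hm.le
    have hiN : (i : ℝ) + 1 ≤ N := by exact_mod_cast hi
    have h1 : (i : ℝ) * (T.card * m) ≤ (N - 1) * (T.card * m) :=
      mul_le_mul_of_nonneg_right (by linarith) hC
    have hN1 : (1 : ℝ) ≤ N := by exact_mod_cast (by omega : 1 ≤ N)
    nlinarith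
  have hmass : ∀ i ≤ N, ν.real (A i) ≤ i * (T.card * m) := by
    intro i
    induction i with
    | zero => intro _; simp [hA0]
    | succ i ih =>
      intro hi
      have h1 := ih (by omega)
      obtain ⟨-, h2⟩ := hXP (A i) (hcompl i (by omega) h1)
      have h3 := measureReal_ball_diff_lt (ν := ν) hne hT (X (A i)) (hrp (P (A i)))
        (R := 12 * (r / 4 ^ (P (A i) + 1))) (by linarith [hrp (P (A i))]) (A i) (m := m)
        (fun y => by rw [hstep]; exact h2 _ (Nat.lt_succ_self _) y)
      rw [hAs, ← Set.union_sdiff_self]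
      refine (measureReal_union_le _ _).trans ?_
      push_cast
      linarith
  have hprop : ∀ i < N, m ≤ ν.real (Metric.ball (X (A i)) (r / 4 ^ (P (A i) + 1)) \ A i) ∧
      ∀ q > P (A i), ∀ y, ν.real (Metric.ball y (r / 4 ^ (q + 1)) \ A i) < m := fun i hi =>
    hXP (A i) (hcompl i hi (hmass i hi.le))
  -- Scales finer than the `j`-th are light outside `A j`, hence also outside the larger set `A i`;
  -- the radii cannot decrease.
  have hP : ∀ i < N, ∀ j < i, P (A i) ≤ P (A j) := by
    intro i hi j hj
    by_contra! hlt
    have h1 := (hprop j (hj.trans hi)).2 _ hlt (X (A i))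
    have h2 := (hprop i hi).1
    have h3 : ν.real (Metric.ball (X (A i)) (r / 4 ^ (P (A i) + 1)) \ A i) ≤
        ν.real (Metric.ball (X (A i)) (r / 4 ^ (P (A i) + 1)) \ A j) :=
      measureReal_mono (Set.sdiff_subset_sdiff_right (hAmono hj.le))
    linarith
  refine ⟨fun i => X (A i), fun i => r / 4 ^ (P (A i) + 1), fun i => ⟨hrp _, ?_⟩, ?_, ?_, ?_⟩
  · change r / 4 ^ (P (A i) + 1) ≤ r / 4
    rw [pow_succ, mul_comm, ← div_div]
    exact div_le_self (by positivity) (one_le_pow₀ (by norm_num))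
  · intro i hi
    refine (hprop i hi).1.trans (le_of_eq ?_)
    congr 2
    exact hAU i
  · intro i hi j hj
    have := hP i hi j hj
    change r / 4 ^ (P (A j) + 1) ≤ r / 4 ^ (P (A i) + 1)
    gcongr
    norm_num
  · intro i hi j hj hlt
    have h1 : P (A i) < P (A j) := by
      refine lt_of_le_of_ne (hP i hi j hj) fun h => ?_
      change r / 4 ^ (P (A j) + 1) < r / 4 ^ (P (A i) + 1) at hlt
      rw [h] at hlt
      exact lt_irrefl _ hlt
    have h2 : r / 4 ^ (P (A j) + 1) ≤ r / 4 ^ (P (A i) + 1 + 1) := by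
      gcongr
      · norm_num
      · omega
    have h3 := hstep (P (A i))
    change 4 * (r / 4 ^ (P (A j) + 1)) ≤ r / 4 ^ (P (A i) + 1)
    linarith

end Greedy

/-! ### A smooth maximum with gradient bound independent of the number of functions. -/

section SmoothMax

/-- The derivative of the smooth transition function is bounded on the unit interval. -/
lemma exists_bound_deriv_smoothTransition :
    ∃ L : ℝ, 0 < L ∧ ∀ t ∈ Set.Icc (-1 : ℝ) 2, ‖deriv Real.smoothTransition t‖ ≤ L := by
  have hc : Continuous (deriv Real.smoothTransition) :=
    (Real.smoothTransition.contDiff (n := 1)).continuous_deriv le_rfl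
  obtain ⟨C, hC⟩ := (isCompact_Icc (a := (-1 : ℝ)) (b := 2)).exists_bound_of_continuousOn
    hc.continuousOn
  exact ⟨max C 1, by positivity, fun t ht => (hC t ht).trans (le_max_left _ _)⟩

lemma deriv_smoothTransition_of_neg {t : ℝ} (ht : t < 0) :
    deriv Real.smoothTransition t = 0 := by
  have : Real.smoothTransition =ᶠ[nhds t] fun _ => 0 := by
    filter_upwards [Iio_mem_nhds ht] with s hs
    exact Real.smoothTransition.zero_of_nonpos (le_of_lt hs)
  rw [this.deriv_eq]; simp

lemma deriv_smoothTransition_of_one_lt {t : ℝ} (ht : 1 < t) :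
    deriv Real.smoothTransition t = 0 := by
  have : Real.smoothTransition =ᶠ[nhds t] fun _ => 1 := by
    filter_upwards [Ioi_mem_nhds ht] with s hs
    exact Real.smoothTransition.one_of_one_le (le_of_lt hs)
  rw [this.deriv_eq]; simp

lemma exists_norm_deriv_smoothTransition_le :
    ∃ L : ℝ, 0 < L ∧ ∀ t, ‖deriv Real.smoothTransition t‖ ≤ L := by
  obtain ⟨L, hL, h⟩ := exists_bound_deriv_smoothTransition
  refine ⟨L, hL, fun t => ?_⟩
  rcases lt_or_ge t 0 with h0 | h0
  · rw [deriv_smoothTransition_of_neg h0, norm_zero]; exact hL.le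
  · rcases lt_or_ge 1 t with h1 | h1
    · rw [deriv_smoothTransition_of_one_lt h1, norm_zero]; exact hL.le
    · exact h t ⟨by linarith, by linarith⟩

variable {ι E : Type*} [NormedAddCommGroup E] [NormedSpace ℝ E]

/-- The gradient of a log-sum-exp is a weighted mean of the gradients. -/
lemma hasFDerivAt_log_sum_exp {F : Finset ι} (hF : F.Nonempty) {β : ℝ} (hβ : 0 < β)
    {θ : ι → E → ℝ} {y : E} (hθ : ∀ j, DifferentiableAt ℝ (θ j) y) :
    HasFDerivAt (fun z => Real.log (∑ j ∈ F, Real.exp (β * θ j z)) / β)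
      ((∑ j ∈ F, Real.exp (β * θ j y))⁻¹ •
        ∑ j ∈ F, Real.exp (β * θ j y) • fderiv ℝ (θ j) y) y := by
  have hS : 0 < ∑ j ∈ F, Real.exp (β * θ j y) := Finset.sum_pos (fun _ _ => Real.exp_pos _) hF
  have h1 : HasFDerivAt (fun z => ∑ j ∈ F, Real.exp (β * θ j z))
      (∑ j ∈ F, Real.exp (β * θ j y) • β • fderiv ℝ (θ j) y) y :=
    HasFDerivAt.fun_sum fun j _ => ((hθ j).hasFDerivAt.const_mul β).exp
  have h2 := (h1.log hS.ne').mul_const β⁻¹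
  simp only [← div_eq_mul_inv] at h2
  refine h2.congr_fderiv ?_
  rw [Finset.smul_sum, Finset.smul_sum, Finset.smul_sum]
  refine Finset.sum_congr rfl fun j _ => ?_
  simp only [smul_smul]
  congr 1
  field_simp

lemma exists_norm_weighted_mean_le {F : Finset ι} (hF : F.Nonempty) {w : ι → ℝ}
    (hw : ∀ j, 0 < w j) (v : ι → E) :
    ∃ j ∈ F, ‖(∑ j ∈ F, w j)⁻¹ • ∑ j ∈ F, w j • v j‖ ≤ ‖v j‖ := by
  obtain ⟨j, hj, hmax⟩ := F.exists_max_image (fun j => ‖v j‖) hF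
  refine ⟨j, hj, ?_⟩
  have hS : 0 < ∑ j ∈ F, w j := Finset.sum_pos (fun _ _ => hw _) hF
  rw [norm_smul, norm_inv, Real.norm_of_nonneg hS.le, inv_mul_le_iff₀ hS, Finset.sum_mul]
  refine (norm_sum_le _ _).trans (Finset.sum_le_sum fun l hl => ?_)
  rw [norm_smul, Real.norm_of_nonneg (hw l).le]
  exact mul_le_mul_of_nonneg_left (hmax l hl) (hw l).le

/-- A smooth version of `1 - max_j θ_j`, whose gradient is controlled by the largest gradient of
the `θ_j`, uniformly in the number of functions. -/
lemma exists_smooth_cutoff :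
    ∃ Λ : ℝ, 0 < Λ ∧ ∀ (ι E : Type) [NormedAddCommGroup E] [NormedSpace ℝ E] (F : Finset ι)
      (_ : F.Nonempty) (θ : ι → E → ℝ) (_ : ∀ j, ContDiff ℝ 1 (θ j)),
      ∃ ξ : E → ℝ, ContDiff ℝ 1 ξ ∧
        (∀ y, (∃ j ∈ F, 1 ≤ θ j y) → ξ y = 0) ∧
        (∀ y, (∀ j ∈ F, θ j y ≤ 0) → ξ y = 1) ∧
        ∀ y, ∃ j ∈ F, ‖fderiv ℝ ξ y‖ ≤ Λ * ‖fderiv ℝ (θ j) y‖ := by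
  obtain ⟨L, hL, hLd⟩ := exists_norm_deriv_smoothTransition_le
  refine ⟨2 * L, by positivity, ?_⟩
  intro ι E _ _ F hF θ hθ
  have hcard : (1 : ℝ) ≤ F.card := by exact_mod_cast hF.card_pos
  -- Log-sum-exp exceeds the maximum by at most `log F.card / β ≤ 1 / 2`, a loss absorbed by `2 - 2
  -- * t`, which is at most 0 for `t ≥ 1` and at least 1 for `t ≤ 1 / 2`. The `+ 1` keeps `β`
  -- positive for a single function.
  obtain ⟨β, hβ, hβF⟩ : ∃ β : ℝ, 0 < β ∧ Real.log F.card ≤ β / 2 :=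
    ⟨2 * Real.log F.card + 1, by linarith [Real.log_nonneg hcard], by linarith⟩
  set t : E → ℝ := fun z => Real.log (∑ j ∈ F, Real.exp (β * θ j z)) / β with ht
  have hpos : ∀ y, 0 < ∑ j ∈ F, Real.exp (β * θ j y) := fun y =>
    Finset.sum_pos (fun _ _ => Real.exp_pos _) hF
  have htC : ContDiff ℝ 1 t := by
    refine (ContDiff.log (ContDiff.sum fun j _ => ?_) fun y => (hpos y).ne').div_const β
    exact (contDiff_const.mul (hθ j)).exp
  refine ⟨fun y => Real.smoothTransition (2 - 2 * t y), ?_, ?_, ?_, ?_⟩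
  · exact (Real.smoothTransition.contDiff (n := 1)).comp
      (contDiff_const.sub (contDiff_const.mul htC))
  · rintro y ⟨j, hj, h1⟩
    refine Real.smoothTransition.zero_of_nonpos ?_
    have : 1 ≤ t y := by
      rw [ht, le_div_iff₀ hβ, one_mul, Real.le_log_iff_exp_le (hpos y)]
      calc Real.exp β ≤ Real.exp (β * θ j y) := Real.exp_le_exp.2 (by nlinarith)
        _ ≤ _ := Finset.single_le_sum (f := fun j => Real.exp (β * θ j y))
          (fun _ _ => (Real.exp_pos _).le) hj
    linarith
  · intro y h
    refine Real.smoothTransition.one_of_one_le ?_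
    have : t y ≤ 1 / 2 := by
      rw [ht, div_le_iff₀ hβ]
      have h1 : ∑ j ∈ F, Real.exp (β * θ j y) ≤ F.card := by
        calc ∑ j ∈ F, Real.exp (β * θ j y) ≤ ∑ j ∈ F, (1 : ℝ) :=
              Finset.sum_le_sum fun j hj => by
                rw [Real.exp_le_one_iff]
                exact mul_nonpos_of_nonneg_of_nonpos hβ.le (h j hj)
          _ = F.card := by simp
      linarith [Real.log_le_log (hpos y) h1]
    linarith
  · intro y
    have hd := hasFDerivAt_log_sum_exp hF hβ fun j => (hθ j).differentiable one_ne_zero y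
    obtain ⟨j, hj, hle⟩ := exists_norm_weighted_mean_le hF
      (w := fun j => Real.exp (β * θ j y)) (fun _ => Real.exp_pos _) fun j => fderiv ℝ (θ j) y
    refine ⟨j, hj, ?_⟩
    have hsd : HasDerivAt Real.smoothTransition
        (deriv Real.smoothTransition (2 - 2 * t y)) (2 - 2 * t y) :=
      ((Real.smoothTransition.contDiff (n := 1)).differentiable one_ne_zero _).hasDerivAt
    have h3 := hsd.comp_hasFDerivAt y ((hd.const_mul 2).const_sub 2)
    have h4 : fderiv ℝ (fun y => Real.smoothTransition (2 - 2 * t y)) y = _ := h3.fderiv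
    rw [h4, norm_smul, norm_neg, norm_smul, Real.norm_ofNat, mul_comm 2 L, mul_assoc]
    exact mul_le_mul (hLd _) (by gcongr) (by positivity) hL.le

end SmoothMax

/-! ### Rescaled bump functions. -/

section Bump

variable (E : Type*) [NormedAddCommGroup E] [InnerProductSpace ℝ E] [FiniteDimensional ℝ E]

/-- Rescaled cutoffs of a ball with the natural bound on the gradient. -/
lemma exists_bump {a b : ℝ} (ha : 0 < a) (hab : a < b) :
    ∃ L : ℝ, 0 < L ∧ ∀ (x : E) (ρ : ℝ), 0 < ρ → ∃ g : E → ℝ, ContDiff ℝ 1 g ∧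
      (∀ y, dist y x ≤ a * ρ → g y = 1) ∧ (∀ y, b * ρ ≤ dist y x → g y = 0) ∧
      (∀ y, ‖fderiv ℝ g y‖ ≤ L / ρ) ∧ ∀ y, b * ρ < dist y x → fderiv ℝ g y = 0 := by
  let h : ContDiffBump (0 : E) := ⟨a, b, ha, hab⟩
  have hC : ContDiff ℝ 1 h := h.contDiff
  obtain ⟨L, hL⟩ := (hC.continuous_fderiv one_ne_zero).bounded_above_of_compact_support
    (h.hasCompactSupport.fderiv ℝ)
  refine ⟨max L 1, by positivity, fun x ρ hρ => ?_⟩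
  have hdist : ∀ y, ‖ρ⁻¹ • (y - x)‖ = dist y x / ρ := fun y => by
    rw [norm_smul, norm_inv, Real.norm_of_nonneg hρ.le, dist_eq_norm, div_eq_inv_mul]
  have h0 : ∀ y, b * ρ ≤ dist y x → h (ρ⁻¹ • (y - x)) = 0 := fun y hy => by
    refine h.zero_of_le_dist ?_
    rw [dist_zero_right, hdist, le_div_iff₀ hρ]
    exact hy
  refine ⟨fun y => h (ρ⁻¹ • (y - x)), ?_, ?_, h0, ?_, ?_⟩
  · exact hC.comp (contDiff_const.smul (contDiff_id.sub contDiff_const))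
  · intro y hy
    refine h.one_of_mem_closedBall ?_
    rw [mem_closedBall_zero_iff, hdist, div_le_iff₀ hρ]
    exact hy
  · intro y
    have h1 : HasFDerivAt (fun y : E => ρ⁻¹ • (y - x)) (ρ⁻¹ • ContinuousLinearMap.id ℝ E) y :=
      ((hasFDerivAt_id y).sub_const x).const_smul ρ⁻¹
    have h2 := ((hC.differentiable one_ne_zero (ρ⁻¹ • (y - x))).hasFDerivAt).comp y h1
    have h3 : fderiv ℝ (fun y => h (ρ⁻¹ • (y - x))) y = _ := h2.fderiv
    rw [h3, ContinuousLinearMap.comp_smul, ContinuousLinearMap.comp_id, norm_smul, norm_inv,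
      Real.norm_of_nonneg hρ.le, div_eq_inv_mul]
    gcongr
    exact (hL _).trans (le_max_left _ _)
  · intro y hy
    have : (fun y => h (ρ⁻¹ • (y - x))) =ᶠ[nhds y] fun _ => 0 := by
      have ho : IsOpen {z : E | b * ρ < dist z x} :=
        isOpen_lt continuous_const (continuous_id.dist continuous_const)
      filter_upwards [ho.mem_nhds hy] with z hz
      exact h0 z (le_of_lt hz)
    rw [this.fderiv_eq]; simp

end Bump

/-! ### Active balls and their number. -/

section Active

variable {E : Type*} [NormedAddCommGroup E]

open Classical in
/-- Among the balls `B(x j, ρ j)` with `j < i`, those whose dilation meets `B(x i, 2 ρ i)` and has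
not met a larger ball in between. -/
noncomputable def activeIndices (x : ℕ → E) (ρ : ℕ → ℝ) (i : ℕ) : Finset ℕ :=
  (Finset.range i).filter fun j => dist (x j) (x i) < 12 * ρ j + 2 * ρ i ∧
    ∀ l, j < l → l < i → ρ j < ρ l → 12 * ρ j + 2 * ρ l ≤ dist (x j) (x l)

lemma mem_activeIndices {x : ℕ → E} {ρ : ℕ → ℝ} {i j : ℕ} :
    j ∈ activeIndices x ρ i ↔ j < i ∧ dist (x j) (x i) < 12 * ρ j + 2 * ρ i ∧
      ∀ l, j < l → l < i → ρ j < ρ l → 12 * ρ j + 2 * ρ l ≤ dist (x j) (x l) := by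
  simp [activeIndices]

variable {x : ℕ → E} {ρ : ℕ → ℝ} {N : ℕ}

/-- The balls `B(x j, 8 ρ j)` of active index `j` cover all preceding ones inside
`B(x i, 2 ρ i)`. -/
lemma exists_mem_activeIndices (hρ : ∀ i, 0 < ρ i)
    (h4 : ∀ i < N, ∀ j < i, ρ j < ρ i → 4 * ρ j ≤ ρ i) {i : ℕ} (hi : i < N) {y : E}
    (hy : dist y (x i) ≤ 2 * ρ i) {j : ℕ} (hj : j < i) (hyj : dist y (x j) ≤ 8 * ρ j) :
    ∃ l ∈ activeIndices x ρ i, dist y (x l) ≤ 8 * ρ l := by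
  induction hd : i - j using Nat.strong_induction_on generalizing j with
  | _ d ih =>
    by_cases hact : j ∈ activeIndices x ρ i
    · exact ⟨j, hact, hyj⟩
    have hmeet : dist (x j) (x i) < 12 * ρ j + 2 * ρ i := by
      have := dist_triangle_left (x j) (x i) y
      linarith [hρ j]
    simp only [mem_activeIndices, hj, hmeet, true_and, not_forall, not_le] at hact
    obtain ⟨l, hjl, hli, hlt, hdl⟩ := hact
    -- A larger ball `l` that intervened takes over from `j`: since `4 ρ j ≤ ρ l`, the distance from
    -- `y` to `x l` is at most `8 ρ j + 12 ρ j + 2 ρ l ≤ 7 ρ l`.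
    refine ih (i - l) (by omega) hli ?_ rfl
    have := h4 l (hli.trans hi) j hjl hlt
    have := dist_triangle y (x j) (x l)
    linarith

variable [NormedSpace ℝ E]

/-- Indices `i` with `ρ i = ρ j` have centres in `B(x j, 14 ρ j)` at mutual distance at least `11 ρ
j`, so each small covering ball holds at most one. Among the larger balls only the first can count:
meeting it makes `j` inactive for all later ones. -/
lemma card_filter_mem_activeIndices_le {T : Finset E}
    (hT : Metric.closedBall (0 : E) 14 ⊆ ⋃ t ∈ T, Metric.ball t (1 / 4)) (hρ : ∀ i, 0 < ρ i)
    (hmono : ∀ i < N, ∀ j < i, ρ j ≤ ρ i)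
    (hsep : ∀ i < N, ∀ j < i, ∃ y, dist y (x i) < ρ i ∧ 12 * ρ j ≤ dist y (x j)) (j : ℕ) :
    ((Finset.range N).filter fun i => j ∈ activeIndices x ρ i).card ≤ T.card + 1 := by
  classical
  set S := (Finset.range N).filter fun i => j ∈ activeIndices x ρ i with hS
  have hmem : ∀ i ∈ S, i < N ∧ j < i ∧ dist (x j) (x i) < 12 * ρ j + 2 * ρ i ∧
      ∀ l, j < l → l < i → ρ j < ρ l → 12 * ρ j + 2 * ρ l ≤ dist (x j) (x l) := by
    intro i hi
    rw [hS, Finset.mem_filter, Finset.mem_range, mem_activeIndices] at hi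
    exact hi
  rw [← Finset.card_filter_add_card_filter_not (s := S) (fun i => ρ i = ρ j)]
  refine add_le_add ?_ ?_
  · have hball : ∀ i ∈ S.filter (fun i => ρ i = ρ j),
        ∃ t ∈ T, x i ∈ Metric.ball (x j + ρ j • t) (ρ j / 4) := by
      intro i hi
      obtain ⟨hiS, hρi⟩ := Finset.mem_filter.1 hi
      obtain ⟨-, -, hd, -⟩ := hmem i hiS
      have h1 : x i ∈ Metric.ball (x j) (14 * ρ j) := by
        rw [Metric.mem_ball, dist_comm]
        linarith
      have := ball_subset_iUnion_ball hT (x j) (hρ j) le_rfl h1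
      simpa only [Set.mem_iUnion, exists_prop] using this
    choose! τ hτ hxτ using hball
    have hne : ∀ i ∈ S.filter (fun i => ρ i = ρ j), ∀ i' ∈ S.filter (fun i => ρ i = ρ j),
        i < i' → τ i ≠ τ i' := by
      intro i hi i' hi' hlt heq
      have h1 := hxτ i hi
      have h2 := hxτ i' hi'
      rw [← heq] at h2
      obtain ⟨hiS, hρi⟩ := Finset.mem_filter.1 hi
      obtain ⟨hiS', hρi'⟩ := Finset.mem_filter.1 hi'
      obtain ⟨y, hy1, hy2⟩ := hsep i' (hmem i' hiS').1 i hlt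
      rw [Metric.mem_ball] at h1 h2
      have h3 := dist_triangle_right (x i') (x i) (x j + ρ j • τ i)
      have h4 := dist_triangle y (x i') (x i)
      linarith [hρ j]
    refine Finset.card_le_card_of_injOn τ hτ fun i hi i' hi' heq => ?_
    rcases lt_trichotomy i i' with h | h | h
    · exact absurd heq (hne i hi i' hi' h)
    · exact h
    · exact absurd heq.symm (hne i' hi' i hi h)
  · have hno : ∀ i ∈ S.filter (fun i => ¬ ρ i = ρ j), ∀ i' ∈ S.filter (fun i => ¬ ρ i = ρ j),
        ¬ i < i' := by
      intro i hi i' hi' hlt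
      obtain ⟨hiS, hρi⟩ := Finset.mem_filter.1 hi
      obtain ⟨hiS', -⟩ := Finset.mem_filter.1 hi'
      obtain ⟨hiN, hji, hd, -⟩ := hmem i hiS
      have := (hmem i' hiS').2.2.2 i hji hlt (lt_of_le_of_ne (hmono i hiN j hji) (Ne.symm hρi))
      linarith
    refine Finset.card_le_one.2 fun i hi i' hi' => ?_
    exact le_antisymm (not_lt.1 (hno i' hi' i hi)) (not_lt.1 (hno i hi i' hi'))

/-- Double counting: a single set of active indices may be large, but each `j` is active for
boundedly many `i`. -/
lemma sum_card_activeIndices_le {T : Finset E}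
    (hT : Metric.closedBall (0 : E) 14 ⊆ ⋃ t ∈ T, Metric.ball t (1 / 4)) (hρ : ∀ i, 0 < ρ i)
    (hmono : ∀ i < N, ∀ j < i, ρ j ≤ ρ i)
    (hsep : ∀ i < N, ∀ j < i, ∃ y, dist y (x i) < ρ i ∧ 12 * ρ j ≤ dist y (x j)) :
    ∑ i ∈ Finset.range N, (activeIndices x ρ i).card ≤ N * (T.card + 1) := by
  classical
  have h1 : ∀ i ∈ Finset.range N, (activeIndices x ρ i).card =
      ((Finset.range N).filter fun j => j ∈ activeIndices x ρ i).card := by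
    intro i hi
    congr 1
    ext j
    simp only [Finset.mem_filter, Finset.mem_range]
    refine ⟨fun h => ⟨?_, h⟩, fun h => h.2⟩
    exact (mem_activeIndices.1 h).1.trans (Finset.mem_range.1 hi)
  rw [Finset.sum_congr rfl h1]
  calc _ = ∑ j ∈ Finset.range N, ((Finset.range N).filter fun i => j ∈ activeIndices x ρ i).card :=
        Finset.sum_card_bipartiteAbove_eq_sum_card_bipartiteBelow
          (fun i j => j ∈ activeIndices x ρ i)
    _ ≤ ∑ _j ∈ Finset.range N, (T.card + 1) :=
        Finset.sum_le_sum fun j _ => card_filter_mem_activeIndices_le hT hρ hmono hsep j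
    _ = N * (T.card + 1) := by simp

end Active

/-! ### Cutoffs and their energy. -/

/-- A cutoff of `B(x i, ρ i)` vanishing on the balls `B(x j, 8 ρ j)`, `j < i`. -/
lemma exists_cutoff (n : ℕ) : ∃ D : ℝ, 0 < D ∧
    ∀ (x : ℕ → EuclideanSpace ℝ (Fin n)) (ρ : ℕ → ℝ) (N : ℕ), (∀ i, 0 < ρ i) →
      (∀ i < N, ∀ j < i, ρ j < ρ i → 4 * ρ j ≤ ρ i) → ∀ i < N,
      ∃ ξ : EuclideanSpace ℝ (Fin n) → ℝ, ContDiff ℝ 1 ξ ∧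
        (∀ y, 2 * ρ i ≤ dist y (x i) → ξ y = 0) ∧
        (∀ j < i, ∀ y, dist y (x j) ≤ 8 * ρ j → ξ y = 0) ∧
        (∀ y, dist y (x i) < ρ i → (∀ j < i, 12 * ρ j ≤ dist y (x j)) → ξ y = 1) ∧
        ∀ y, fderiv ℝ ξ y = 0 ∨ ∃ j ∈ insert i (activeIndices x ρ i),
          ‖fderiv ℝ ξ y‖ ≤ D / ρ j ∧ dist y (x j) ≤ 12 * ρ j := by
  obtain ⟨Λ, hΛ, hcut⟩ := exists_smooth_cutoff
  obtain ⟨L₁, hL₁, hb₁⟩ := exists_bump (EuclideanSpace ℝ (Fin n)) (a := 1) (b := 2)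
    (by norm_num) (by norm_num)
  obtain ⟨L₂, hL₂, hb₂⟩ := exists_bump (EuclideanSpace ℝ (Fin n)) (a := 8) (b := 12)
    (by norm_num) (by norm_num)
  refine ⟨Λ * (L₁ + L₂), by positivity, ?_⟩
  intro x ρ N hρ h4 i hi
  obtain ⟨g, hg, hg1, hg0, hgD, hgD0⟩ := hb₁ (x i) (ρ i) (hρ i)
  choose G hG hG1 hG0 hGD hGD0 using fun j => hb₂ (x j) (ρ j) (hρ j)
  -- Each `θ j` equals 1 where `ξ` must vanish: outside `B(x i, 2 ρ i)` for `j = i`, on `B(x j, 8 ρ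
  -- j)` for active `j`. The non-active balls are then covered by `exists_mem_activeIndices`.
  let θ : ℕ → EuclideanSpace ℝ (Fin n) → ℝ := fun j => if j = i then fun y => 1 - g y else G j
  have hθi : θ i = fun y => 1 - g y := if_pos rfl
  have hθj : ∀ j, j ≠ i → θ j = G j := fun j h => if_neg h
  have hne : ∀ j ∈ activeIndices x ρ i, j ≠ i := fun j hj => (mem_activeIndices.1 hj).1.ne
  have hθC : ∀ j, ContDiff ℝ 1 (θ j) := by
    intro j
    by_cases h : j = i
    · rw [h, hθi]; exact contDiff_const.sub hg
    · rw [hθj j h]; exact hG j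
  have hθD : ∀ j y, ‖fderiv ℝ (θ j) y‖ ≤ (L₁ + L₂) / ρ j ∧
      (12 * ρ j < dist y (x j) → fderiv ℝ (θ j) y = 0) := by
    intro j y
    by_cases h : j = i
    · subst h
      rw [hθi, fderiv_const_sub, norm_neg, neg_eq_zero]
      refine ⟨(hgD y).trans ?_, fun hy => hgD0 y ?_⟩
      · have := (hρ j).le
        gcongr
        linarith
      · linarith [hρ j]
    · rw [hθj j h]
      refine ⟨(hGD j y).trans ?_, fun hy => hGD0 j y hy⟩
      have := (hρ j).le
      gcongr
      linarith
  obtain ⟨ξ, hξC, hξ0, hξ1, hξD⟩ := hcut ℕ (EuclideanSpace ℝ (Fin n))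
    (insert i (activeIndices x ρ i)) (Finset.insert_nonempty _ _) θ hθC
  have hz : ∀ y, 2 * ρ i ≤ dist y (x i) → ξ y = 0 := fun y hy => by
    refine hξ0 y ⟨i, Finset.mem_insert_self _ _, ?_⟩
    rw [hθi]
    simp [hg0 y hy]
  refine ⟨ξ, hξC, hz, ?_, ?_, ?_⟩
  · intro j hj y hy
    rcases le_or_gt (2 * ρ i) (dist y (x i)) with h | h
    · exact hz y h
    · obtain ⟨l, hl, hyl⟩ := exists_mem_activeIndices hρ h4 hi h.le hj hy
      refine hξ0 y ⟨l, Finset.mem_insert_of_mem hl, ?_⟩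
      rw [hθj l (hne l hl), hG1 l y hyl]
  · intro y hy hyj
    refine hξ1 y fun j hj => ?_
    rcases Finset.mem_insert.1 hj with rfl | hj
    · rw [hθi]
      simp [hg1 y (by linarith)]
    · rw [hθj j (hne j hj), hG0 j y (hyj j (mem_activeIndices.1 hj).1)]
  · intro y
    obtain ⟨j, hj, hle⟩ := hξD y
    obtain ⟨h1, h2⟩ := hθD j y
    rcases lt_or_ge (12 * ρ j) (dist y (x j)) with h | h
    · left
      rw [h2 h, norm_zero, mul_zero] at hle
      exact norm_le_zero_iff.1 hle
    · refine Or.inr ⟨j, hj, hle.trans ?_, h⟩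
      rw [mul_div_assoc]
      gcongr

/-- Trades the 2-energy for volume plus `n`-energy, in place of Hölder's inequality. The `n`-energy
is scale invariant: a cutoff at scale `ρ` costs about `ρ^(-n) * ρ^n`, whatever `ρ`. -/
lemma sq_le_add_mul_pow {n : ℕ} (hn : 2 ≤ n) {a s : ℝ} (ha : 0 ≤ a) (hs : 0 < s) :
    a ^ 2 ≤ s ^ 2 + s ^ 2 / s ^ n * a ^ n := by
  rcases le_total a s with h | h
  · have h1 : a ^ 2 ≤ s ^ 2 := by gcongr
    have h2 : 0 ≤ s ^ 2 / s ^ n * a ^ n := by positivity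
    linarith
  · obtain ⟨l, rfl⟩ := Nat.exists_eq_add_of_le hn
    have h1 : s ^ 2 / s ^ (2 + l) * a ^ (2 + l) = a ^ 2 * (a / s) ^ l := by
      rw [pow_add, pow_add, div_pow]
      field_simp
    have h2 : 1 ≤ (a / s) ^ l := one_le_pow₀ ((one_le_div hs).2 h)
    rw [h1]
    nlinarith [sq_nonneg a, sq_nonneg s]

lemma measureReal_closedBall_eq {n : ℕ} (x : EuclideanSpace ℝ (Fin n)) {R : ℝ} (hR : 0 ≤ R) :
    volume.real (Metric.closedBall x R) =
      R ^ n * volume.real (Metric.ball (0 : EuclideanSpace ℝ (Fin n)) 1) := by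
  rw [Measure.real, Measure.addHaar_closedBall volume x hR, ENNReal.toReal_mul,
    ENNReal.toReal_ofReal (by positivity), finrank_euclideanSpace_fin]
  rfl

/-- Energy of a function whose gradient is dominated by those of cutoffs of given balls. -/
lemma integral_sq_norm_fderiv_le {n : ℕ} (hn : 2 ≤ n) {ξ : EuclideanSpace ℝ (Fin n) → ℝ}
    (hsupp : HasCompactSupport ξ) {x : ℕ → EuclideanSpace ℝ (Fin n)} {ρ : ℕ → ℝ}
    (hρ : ∀ i, 0 < ρ i) {D s : ℝ} (hD : 0 < D) (hs : 0 < s) (F : Finset ℕ)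
    (hξ : ∀ y, fderiv ℝ ξ y = 0 ∨
      ∃ j ∈ F, ‖fderiv ℝ ξ y‖ ≤ D / ρ j ∧ dist y (x j) ≤ 12 * ρ j) :
    ∫ y, ‖fderiv ℝ ξ y‖ ^ 2 ≤ s ^ 2 * volume.real (tsupport ξ) +
      s ^ 2 / s ^ n *
        ((12 * D) ^ n * volume.real (Metric.ball (0 : EuclideanSpace ℝ (Fin n)) 1) * F.card) := by
  have hm : MeasurableSet (tsupport ξ) := (isClosed_tsupport ξ).measurableSet
  have hi1 : Integrable ((tsupport ξ).indicator fun _ => s ^ 2 : EuclideanSpace ℝ (Fin n) → ℝ) :=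
    (integrable_indicator_iff hm).2 (integrableOn_const hsupp.measure_lt_top.ne)
  have hi2 : ∀ j, Integrable ((Metric.closedBall (x j) (12 * ρ j)).indicator
      fun _ => (D / ρ j) ^ n : EuclideanSpace ℝ (Fin n) → ℝ) := fun j =>
    (integrable_indicator_iff Metric.isClosed_closedBall.measurableSet).2
      (integrableOn_const measure_closedBall_lt_top.ne)
  have hnn : ∀ j y, 0 ≤ (Metric.closedBall (x j) (12 * ρ j)).indicator
      (fun _ => (D / ρ j) ^ n : EuclideanSpace ℝ (Fin n) → ℝ) y := fun j y =>
    Set.indicator_nonneg (fun _ _ => pow_nonneg (div_nonneg hD.le (hρ j).le) n) y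
  have hnn1 : ∀ y, 0 ≤ (tsupport ξ).indicator
      (fun _ => s ^ 2 : EuclideanSpace ℝ (Fin n) → ℝ) y := fun y =>
    Set.indicator_nonneg (fun _ _ => by positivity) y
  have hpt : ∀ y, ‖fderiv ℝ ξ y‖ ^ 2 ≤ (tsupport ξ).indicator (fun _ => s ^ 2) y +
      s ^ 2 / s ^ n * ∑ j ∈ F, (Metric.closedBall (x j) (12 * ρ j)).indicator
        (fun _ => (D / ρ j) ^ n) y := by
    intro y
    by_cases h0 : fderiv ℝ ξ y = 0
    · rw [h0, norm_zero, zero_pow two_ne_zero]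
      have := Finset.sum_nonneg fun j (_ : j ∈ F) => hnn j y
      have := hnn1 y
      positivity
    · obtain ⟨j, hj, hle, hd⟩ := (hξ y).resolve_left h0
      have hy : y ∈ tsupport ξ := support_fderiv_subset ℝ h0
      rw [Set.indicator_of_mem hy]
      refine (sq_le_add_mul_pow hn (norm_nonneg _) hs).trans ?_
      gcongr
      calc ‖fderiv ℝ ξ y‖ ^ n ≤ (D / ρ j) ^ n := by gcongr
        _ = (Metric.closedBall (x j) (12 * ρ j)).indicator (fun _ => (D / ρ j) ^ n) y := by
          rw [Set.indicator_of_mem (Metric.mem_closedBall.2 hd)]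
        _ ≤ _ := Finset.single_le_sum (f := fun j => (Metric.closedBall (x j) (12 * ρ j)).indicator
          (fun _ => (D / ρ j) ^ n) y) (fun j _ => hnn j y) hj
  have hsum := integrable_finsetSum F fun j _ => hi2 j
  refine (integral_mono_of_nonneg (Filter.Eventually.of_forall fun y => by positivity)
    (hi1.add (hsum.const_mul (s ^ 2 / s ^ n)))
    (Filter.Eventually.of_forall fun y => ?_)).trans (le_of_eq ?_)
  · exact hpt y
  · simp only [Pi.add_apply]
    rw [integral_add hi1 (hsum.const_mul _), integral_const_mul,
      integral_finsetSum F fun j _ => hi2 j, integral_indicator hm, setIntegral_const, smul_eq_mul,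
      mul_comm]
    congr 2
    rw [Finset.sum_congr rfl (g := fun _ => (12 * D) ^ n *
      volume.real (Metric.ball (0 : EuclideanSpace ℝ (Fin n)) 1))]
    · rw [Finset.sum_const, nsmul_eq_mul, mul_comm]
    · intro j _
      rw [integral_indicator Metric.isClosed_closedBall.measurableSet, setIntegral_const,
        smul_eq_mul, measureReal_closedBall_eq _ (by linarith [hρ j]), mul_right_comm, ← mul_pow]
      congr 2
      have := (hρ j).ne'
      field_simp

/-- Disjointly supported test functions of small total energy which all see a fixed proportion of
the given measure. -/
lemma exists_capacitors {n : ℕ} (hn : 2 ≤ n) : ∃ K : ℝ, 0 < K ∧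
    ∀ (ν : Measure (EuclideanSpace ℝ (Fin n))) [IsFiniteMeasure ν]
      (x₀ : EuclideanSpace ℝ (Fin n)) (r : ℝ), 0 < r → ν (Metric.ball x₀ r)ᶜ = 0 →
      (∀ ε > 0, ∃ δ > 0, ∀ y, ν.real (Metric.ball y δ) < ε) → 0 < ν.real Set.univ →
      ∀ (N : ℕ) (s : ℝ), 0 < N → 0 < s →
      ∃ ξ : ℕ → EuclideanSpace ℝ (Fin n) → ℝ,
        (∀ i < N, IsCc 1 (Metric.ball x₀ (2 * r)) (ξ i)) ∧
        (∀ i < N, ∀ j < N, i ≠ j → Disjoint (tsupport (ξ i)) (tsupport (ξ j))) ∧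
        (∀ i < N, ν.real Set.univ ≤ K * N * ν.real {y | ξ i y = 1}) ∧
        ∑ i ∈ Finset.range N, ∫ y, ‖fderiv ℝ (ξ i) y‖ ^ 2 ≤
          K * (s ^ 2 * r ^ n + s ^ 2 / s ^ n * N) := by
  obtain ⟨T, hne, hT⟩ := exists_finset_cover_closedBall (EuclideanSpace ℝ (Fin n))
  obtain ⟨D, hD, hcut⟩ := exists_cutoff n
  set V₁ := volume.real (Metric.ball (0 : EuclideanSpace ℝ (Fin n)) 1) with hV₁
  have hV₁₀ : 0 ≤ V₁ := measureReal_nonneg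
  have hC : (0 : ℝ) < T.card := by exact_mod_cast hne.card_pos
  refine ⟨2 * T.card + 2 ^ n * V₁ + (12 * D) ^ n * V₁ * (T.card + 2), by positivity, ?_⟩
  intro ν _ x₀ r hr hν hsmall hM N s hN hs
  have hN' : (0 : ℝ) < N := by exact_mod_cast hN
  set m := ν.real Set.univ / (2 * T.card * N) with hm
  have hm0 : 0 < m := div_pos hM (mul_pos (mul_pos two_pos hC) hN')
  have hmM : 2 * T.card * N * m = ν.real Set.univ :=
    mul_div_cancel₀ _ (mul_pos (mul_pos two_pos hC) hN').ne'
  obtain ⟨x, ρ, hρ, hmass, hmono, h4⟩ := exists_greedy_balls hne hT hr hm0 hν hsmall hmM.le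
  have hρ0 : ∀ i, 0 < ρ i := fun i => (hρ i).1
  -- Heaviness yields an actual point, which serves both to separate the centres and to tie the ball
  -- to `B(x₀, r)`.
  have hpoint : ∀ i < N, ∃ y, dist y (x i) < ρ i ∧ (∀ j < i, 12 * ρ j ≤ dist y (x j)) ∧
      dist y x₀ < r := by
    intro i hi
    have h1 : 0 < ν.real ((Metric.ball (x i) (ρ i) \ ⋃ j < i, Metric.ball (x j) (12 * ρ j)) ∩
        Metric.ball x₀ r) := by
      refine lt_of_lt_of_le hm0 ((hmass i hi).trans (le_of_eq ?_))
      rw [Measure.real, Measure.real, Set.inter_comm,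
        Measure.measure_inter_eq_of_ae (t := Metric.ball x₀ r) (mem_ae_iff.2 hν)]
    obtain ⟨y, ⟨hy1, hy2⟩, hy3⟩ := nonempty_of_measureReal_ne_zero h1.ne'
    refine ⟨y, hy1, fun j hj => ?_, hy3⟩
    by_contra! hlt
    exact hy2 (Set.mem_iUnion₂.2 ⟨j, hj, hlt⟩)
  choose! ξ hξC hξ0 hξz hξ1 hξD using hcut x ρ N hρ0 h4
  have hts : ∀ i < N, tsupport (ξ i) ⊆ Metric.closedBall (x i) (2 * ρ i) := by
    intro i hi
    refine closure_minimal (fun y hy => ?_) Metric.isClosed_closedBall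
    by_contra hcon
    rw [Metric.mem_closedBall, not_le] at hcon
    exact hy (hξ0 i hi y hcon.le)
  have hts' : ∀ i < N, ∀ j < i, tsupport (ξ i) ⊆ (Metric.ball (x j) (8 * ρ j))ᶜ := by
    intro i hi j hj
    refine closure_minimal (fun y hy hcon => ?_) Metric.isOpen_ball.isClosed_compl
    exact hy (hξz i hi j hj y (Metric.mem_ball.1 hcon).le)
  -- The later support avoids the open ball `B(x j, 8 ρ j)`, while the earlier one lies within `2 ρ
  -- j` of `x j`.
  have hdis : ∀ i < N, ∀ j < i, Disjoint (tsupport (ξ i)) (tsupport (ξ j)) := by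
    intro i hi j hj
    refine Set.disjoint_left.2 fun y hyi hyj => hts' i hi j hj hyi ?_
    have := Metric.mem_closedBall.1 (hts j (hj.trans hi) hyj)
    rw [Metric.mem_ball]
    linarith [hρ0 j]
  have hdisj : ∀ i < N, ∀ j < N, i ≠ j → Disjoint (tsupport (ξ i)) (tsupport (ξ j)) := by
    intro i hi j hj hij
    rcases lt_or_gt_of_ne hij with h | h
    · exact (hdis j hj i h).symm
    · exact hdis i hi j h
  have hcs : ∀ i < N, HasCompactSupport (ξ i) := fun i hi =>
    (isCompact_closedBall _ _).of_isClosed_subset (isClosed_tsupport _) (hts i hi)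
  have hball : ∀ i < N, tsupport (ξ i) ⊆ Metric.ball x₀ (2 * r) := by
    intro i hi y hy
    obtain ⟨z, hz1, -, hz2⟩ := hpoint i hi
    have h1 := Metric.mem_closedBall.1 (hts i hi hy)
    have h2 := dist_triangle_right y z (x i)
    have h3 := dist_triangle y z x₀
    rw [Metric.mem_ball]
    -- Distance to `x₀` is below `2 ρ i + ρ i + r ≤ 3r/4 + r < 2r`.
    linarith [(hρ i).2]
  refine ⟨ξ, fun i hi => ⟨hξC i hi, hcs i hi, hball i hi⟩, hdisj, fun i hi => ?_, ?_⟩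
  · have h1 : m ≤ ν.real {y | ξ i y = 1} := by
      refine (hmass i hi).trans (measureReal_mono ?_ (measure_ne_top ν _))
      rintro y ⟨hy1, hy2⟩
      refine hξ1 i hi y hy1 fun j hj => ?_
      by_contra! hlt
      exact hy2 (Set.mem_iUnion₂.2 ⟨j, hj, hlt⟩)
    have h2 : 0 ≤ 2 ^ n * V₁ + (12 * D) ^ n * V₁ * (T.card + 2) := by positivity
    calc ν.real Set.univ = 2 * T.card * N * m := hmM.symm
      _ ≤ 2 * T.card * N * ν.real {y | ξ i y = 1} := by gcongr
      _ ≤ _ := by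
        refine mul_le_mul_of_nonneg_right (mul_le_mul_of_nonneg_right ?_ hN'.le)
          measureReal_nonneg
        linarith
  · have hsep : ∀ i < N, ∀ j < i, ∃ y, dist y (x i) < ρ i ∧ 12 * ρ j ≤ dist y (x j) := by
      intro i hi j hj
      obtain ⟨y, hy1, hy2, -⟩ := hpoint i hi
      exact ⟨y, hy1, hy2 j hj⟩
    have hcount := sum_card_activeIndices_le hT hρ0 hmono hsep
    have hcount' : ∑ i ∈ Finset.range N, ((insert i (activeIndices x ρ i)).card : ℝ) ≤
        N * (T.card + 2) := by
      have h1 : ∑ i ∈ Finset.range N, (insert i (activeIndices x ρ i)).card ≤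
          N * (T.card + 2) := by
        calc _ ≤ ∑ i ∈ Finset.range N, ((activeIndices x ρ i).card + 1) :=
              Finset.sum_le_sum fun i _ => Finset.card_insert_le _ _
          _ ≤ N * (T.card + 2) := by
            rw [Finset.sum_add_distrib]
            simp only [Finset.sum_const, Finset.card_range, smul_eq_mul, mul_one]
            linarith
      exact_mod_cast h1
    -- Disjoint supports inside `B(x₀, 2r)`: the total volume does not grow with `N`.
    have hvol : ∑ i ∈ Finset.range N, volume.real (tsupport (ξ i)) ≤ 2 ^ n * V₁ * r ^ n := by
      rw [← measureReal_biUnion_finset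
        (fun i hi j hj hij => hdisj i (by simpa using hi) j (by simpa using hj) hij)
        (fun i _ => (isClosed_tsupport _).measurableSet)
        (fun i hi => (hcs i (by simpa using hi)).measure_lt_top.ne)]
      refine (measureReal_mono (Set.iUnion₂_subset fun i hi => (hball i (by simpa using hi)).trans
        Metric.ball_subset_closedBall) measure_closedBall_lt_top.ne).trans (le_of_eq ?_)
      rw [measureReal_closedBall_eq _ (by positivity), mul_pow]
      ring
    calc _ ≤ ∑ i ∈ Finset.range N, (s ^ 2 * volume.real (tsupport (ξ i)) + s ^ 2 / s ^ n *
          ((12 * D) ^ n * V₁ * (insert i (activeIndices x ρ i)).card)) :=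
          Finset.sum_le_sum fun i hi => by
            have hi' := Finset.mem_range.1 hi
            exact integral_sq_norm_fderiv_le hn (hcs i hi') hρ0 hD hs _ (hξD i hi')
      _ = s ^ 2 * ∑ i ∈ Finset.range N, volume.real (tsupport (ξ i)) + s ^ 2 / s ^ n *
          ((12 * D) ^ n * V₁ *
            ∑ i ∈ Finset.range N, ((insert i (activeIndices x ρ i)).card : ℝ)) := by
          rw [Finset.sum_add_distrib, ← Finset.mul_sum, ← Finset.mul_sum, ← Finset.mul_sum]
      _ ≤ s ^ 2 * (2 ^ n * V₁ * r ^ n) + s ^ 2 / s ^ n * ((12 * D) ^ n * V₁ * (N * (T.card + 2))) := by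
          gcongr
      _ = (2 ^ n * V₁) * (s ^ 2 * r ^ n) +
          ((12 * D) ^ n * V₁ * (T.card + 2)) * (s ^ 2 / s ^ n * N) := by ring
      _ ≤ _ := by
          have h1 : 0 ≤ s ^ 2 * r ^ n := by positivity
          have h2 : 0 ≤ s ^ 2 / s ^ n * N := by positivity
          have h3 : 0 ≤ 2 ^ n * V₁ := by positivity
          have h4 : 0 ≤ (12 * D) ^ n * V₁ * (T.card + 2) := by positivity
          rw [mul_add (2 * (T.card : ℝ) + _ + _)]
          refine add_le_add (mul_le_mul_of_nonneg_right ?_ h1) (mul_le_mul_of_nonneg_right ?_ h2)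
          all_goals linarith

/-! ### The measure with density `f'(u)`. -/

section Density

variable {n : ℕ} {g : EuclideanSpace ℝ (Fin n) → ℝ} {B : Set (EuclideanSpace ℝ (Fin n))}

lemma measureReal_withDensity_restrict (hg : ∀ y, 0 ≤ g y) (hi : IntegrableOn g B)
    {S : Set (EuclideanSpace ℝ (Fin n))} (hS : MeasurableSet S) :
    ((volume.restrict B).withDensity fun y => ENNReal.ofReal (g y)).real S =
      ∫ y in S ∩ B, g y := by
  rw [Measure.real, withDensity_apply _ hS, Measure.restrict_restrict hS,
    integral_eq_lintegral_of_nonneg_ae (Filter.Eventually.of_forall hg)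
      (hi.mono_set Set.inter_subset_right).aestronglyMeasurable]

/-- Absolute continuity of the integral, uniform in the centre because the volume of a ball depends
only on its radius and, for `n ≠ 0`, tends to 0 with it. -/
lemma exists_ball_measureReal_lt (hn : n ≠ 0) (hi : IntegrableOn g B) {ε : ℝ} (hε : 0 < ε) :
    ∃ δ > 0, ∀ y, ((volume.restrict B).withDensity fun y => ENNReal.ofReal (g y)).real
      (Metric.ball y δ) < ε := by
  have hfin : ∫⁻ y in B, ENNReal.ofReal (g y) ≠ ⊤ := by
    refine ((lintegral_mono fun y => ?_).trans_lt hi.hasFiniteIntegral).ne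
    exact Real.ofReal_le_enorm (g y)
  obtain ⟨η, hη, hlt⟩ := exists_pos_setLIntegral_lt_of_measure_lt hfin
    (ENNReal.ofReal_pos.2 hε).ne'
  have hlim : Filter.Tendsto (fun δ : ℝ => ENNReal.ofReal (δ ^ n) *
      volume (Metric.ball (0 : EuclideanSpace ℝ (Fin n)) 1)) (nhds 0) (nhds 0) := by
    have h1 : Filter.Tendsto (fun δ : ℝ => ENNReal.ofReal (δ ^ n)) (nhds 0) (nhds 0) := by
      have := ENNReal.tendsto_ofReal ((continuous_pow n).tendsto (0 : ℝ))
      simpa [zero_pow hn] using this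
    simpa using ENNReal.Tendsto.mul_const h1 (Or.inr measure_ball_lt_top.ne)
  have hev := (hlim.eventually (gt_mem_nhds hη)).filter_mono
    (nhdsWithin_le_nhds (s := Set.Ioi (0 : ℝ)))
  obtain ⟨δ, hδ, hδ0⟩ := (hev.and self_mem_nhdsWithin).exists
  refine ⟨δ, hδ0, fun y => ?_⟩
  rw [Measure.real, withDensity_apply _ Metric.isOpen_ball.measurableSet]
  refine ENNReal.toReal_lt_of_lt_ofReal (hlt _ ((Measure.restrict_apply_le _ _).trans_lt ?_))
  rw [Measure.addHaar_ball_of_pos volume y hδ0, finrank_euclideanSpace_fin]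
  exact hδ

end Density

lemma sq_div_pow_identity {n : ℕ} (hn : 2 ≤ n) {a r : ℝ} (ha : 0 < a) (hr : 0 < r) :
    (a ^ (1 / (n : ℝ)) / r) ^ n = a / r ^ n ∧
      (a ^ (1 / (n : ℝ)) / r) ^ 2 * r ^ n = a ^ (2 / (n : ℝ)) * r ^ ((n : ℝ) - 2) := by
  have hn0 : (n : ℝ) ≠ 0 := by positivity
  constructor
  · rw [div_pow, ← Real.rpow_natCast (a ^ (1 / (n : ℝ))), ← Real.rpow_mul ha.le,
      one_div_mul_cancel hn0, Real.rpow_one]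
  · rw [div_pow, ← Real.rpow_natCast (a ^ (1 / (n : ℝ))), ← Real.rpow_mul ha.le,
      Real.rpow_sub hr, Real.rpow_natCast, Real.rpow_ofNat]
    have : 1 / (n : ℝ) * ((2 : ℕ) : ℝ) = 2 / n := by push_cast; ring
    rw [this]
    ring

/-! ### The integral estimate of part (ii). -/

section Estimate

variable {n : ℕ} {U : Set (EuclideanSpace ℝ (Fin n))} {f : ℝ → ℝ}
  {u : EuclideanSpace ℝ (Fin n) → ℝ}

lemma MorseIndexLE.card_filter_Q_neg_le {k : ℕ} (hI : MorseIndexLE f u U k) {N : ℕ}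
    {ξ : ℕ → EuclideanSpace ℝ (Fin n) → ℝ} (hc : ∀ i < N, IsCc 1 U (ξ i))
    (hdisj : ∀ i < N, ∀ j < N, i ≠ j → Disjoint (tsupport (ξ i)) (tsupport (ξ j))) :
    ((Finset.range N).filter fun i => Q f u U (ξ i) < 0).card ≤ k := by
  by_contra! hlt
  let e := Finset.orderEmbOfCardLe _ (Nat.succ_le_of_lt hlt)
  have he : ∀ i, e i < N ∧ Q f u U (ξ (e i)) < 0 := fun i => by
    have := Finset.orderEmbOfCardLe_mem _ (Nat.succ_le_of_lt hlt) i
    rw [Finset.mem_filter, Finset.mem_range] at this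
    exact this
  exact hI.not_forall_Q_neg (ξ := fun i => ξ (e i)) (fun i => hc _ (he i).1)
    (fun i j hij => hdisj _ (he i).1 _ (he j).1 (e.injective.ne hij)) fun i => (he i).2

/-- Estimate of `∫ f'(u)` on a ball by a power of the Morse index. -/
lemma exists_integral_deriv_le (hn : 2 ≤ n) : ∃ C : ℝ, 0 < C ∧
    ∀ (U : Set (EuclideanSpace ℝ (Fin n))) (f : ℝ → ℝ) (u : EuclideanSpace ℝ (Fin n) → ℝ) (k : ℕ),
      Monotone f → MorseIndexLE f u U k →
      ∀ (x : EuclideanSpace ℝ (Fin n)) (r : ℝ), 0 < r → Metric.ball x (2 * r) ⊆ U →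
        IntegrableOn (fun y => deriv f (u y)) (Metric.ball x r) ∧
        ∫ y in Metric.ball x r, deriv f (u y) ≤
          C * (1 + (k : ℝ)) ^ (2 / (n : ℝ)) * r ^ ((n : ℝ) - 2) := by
  obtain ⟨K, hK, hcap⟩ := exists_capacitors hn
  refine ⟨6 * K ^ 2, by positivity, ?_⟩
  intro U f u k hf hI x r hr hU
  obtain ⟨_, _, hloc, _⟩ := id hI
  set g : EuclideanSpace ℝ (Fin n) → ℝ := fun y => deriv f (u y) with hg
  have hg0 : ∀ y, 0 ≤ g y := fun y => hf.deriv_nonneg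
  have hi : IntegrableOn g (Metric.ball x r) := by
    refine (hloc.integrableOn_compact_subset (fun y hy => hU ?_)
      (isCompact_closedBall x r)).mono_set Metric.ball_subset_closedBall
    have := Metric.mem_closedBall.1 hy
    rw [Metric.mem_ball]
    linarith
  refine ⟨hi, ?_⟩
  have hk : (0 : ℝ) < 1 + k := by positivity
  rcases (setIntegral_nonneg Metric.isOpen_ball.measurableSet fun y _ => hg0 y :
    0 ≤ ∫ y in Metric.ball x r, g y).eq_or_lt with hM | hM
  -- Zero mass is set aside, since the greedy selection needs a positive threshold.
  · rw [← hM]; positivity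
  set ν := (volume.restrict (Metric.ball x r)).withDensity fun y => ENNReal.ofReal (g y) with hν
  have : IsFiniteMeasure ν := isFiniteMeasure_withDensity_ofReal hi.hasFiniteIntegral
  have hνreal : ∀ S, MeasurableSet S → ν.real S = ∫ y in S ∩ Metric.ball x r, g y := fun S hS =>
    measureReal_withDensity_restrict hg0 hi hS
  have hνU : ν.real Set.univ = ∫ y in Metric.ball x r, g y := by
    rw [hνreal _ MeasurableSet.univ, Set.univ_inter]
  have hνc : ν (Metric.ball x r)ᶜ = 0 := by
    refine withDensity_absolutelyContinuous _ _ ?_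
    rw [Measure.restrict_apply Metric.isOpen_ball.measurableSet.compl, Set.compl_inter_self,
      measure_empty]
  -- Balances the two energy terms: `s^n = (1 + k) / r^n` makes `s² / s^n * (1 + k)` equal to `s² *
  -- r^n`.
  set s := (1 + (k : ℝ)) ^ (1 / (n : ℝ)) / r with hs
  have hs0 : 0 < s := by positivity
  obtain ⟨ξ, hξc, hξd, hξm, hξE⟩ := hcap ν x r hr hνc
    (fun ε hε => exists_ball_measureReal_lt (by omega) hi hε) (hνU ▸ hM) (2 * (k + 1)) s
    (by omega) hs0
  have hξU : ∀ i < 2 * (k + 1), IsCc 1 U (ξ i) := fun i hi => (hξc i hi).mono hU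
  have hneg := hI.card_filter_Q_neg_le hξU hξd
  have hsplit := Finset.card_filter_add_card_filter_not (s := Finset.range (2 * (k + 1)))
    (fun i => Q f u U (ξ i) < 0)
  rw [Finset.card_range] at hsplit
  set P := (Finset.range (2 * (k + 1))).filter fun i => ¬ Q f u U (ξ i) < 0 with hP
  have hPcard : (1 + k : ℝ) ≤ P.card := by
    have : 1 + k ≤ P.card := by omega
    exact_mod_cast this
  -- For `Q ≥ 0` the chain is: mass of `{ξ i = 1}`, at most `∫ f'(u) ξ²`, at most `∫ |∇ξ|²`.
  have hone : ∀ i ∈ P, ν.real Set.univ ≤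
      K * (2 * (1 + k)) * ∫ y, ‖fderiv ℝ (ξ i) y‖ ^ 2 := by
    intro i hi'
    obtain ⟨hiN, hQ⟩ := Finset.mem_filter.1 hi'
    have hiN := Finset.mem_range.1 hiN
    have hc := hξU i hiN
    have hint := hc.integrable_mul_sq hloc
    rw [not_lt, hc.setIntegral_Q_eq, integral_sub hc.integrable_norm_gradient_sq hint,
      sub_nonneg] at hQ
    simp only [norm_gradient_eq] at hQ
    have hmeas : MeasurableSet {y | ξ i y = 1} :=
      (isClosed_eq hc.1.continuous continuous_const).measurableSet
    have hν1 : ν.real {y | ξ i y = 1} ≤ ∫ y, g y * ξ i y ^ 2 := by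
      rw [hνreal _ hmeas]
      calc ∫ y in {y | ξ i y = 1} ∩ Metric.ball x r, g y
          = ∫ y in {y | ξ i y = 1} ∩ Metric.ball x r, g y * ξ i y ^ 2 := by
            refine setIntegral_congr_fun (hmeas.inter Metric.isOpen_ball.measurableSet) ?_
            rintro y ⟨hy, -⟩
            have hy : ξ i y = 1 := hy
            simp [hy]
        _ ≤ _ := setIntegral_le_integral hint
            (Filter.Eventually.of_forall fun y => mul_nonneg (hg0 y) (sq_nonneg _))
    refine (hξm i hiN).trans ?_
    push_cast
    rw [add_comm (k : ℝ) 1]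
    have := hν1.trans hQ
    gcongr
  have hsum : (1 + k) * ν.real Set.univ ≤ K * (2 * (1 + k)) *
      (K * (s ^ 2 * r ^ n + s ^ 2 / s ^ n * (2 * (1 + k)))) := by
    calc (1 + k) * ν.real Set.univ ≤ P.card * ν.real Set.univ := by gcongr
      _ = ∑ i ∈ P, ν.real Set.univ := by simp
      _ ≤ ∑ i ∈ P, K * (2 * (1 + k)) * ∫ y, ‖fderiv ℝ (ξ i) y‖ ^ 2 := Finset.sum_le_sum hone
      _ = K * (2 * (1 + k)) * ∑ i ∈ P, ∫ y, ‖fderiv ℝ (ξ i) y‖ ^ 2 := by rw [Finset.mul_sum]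
      _ ≤ K * (2 * (1 + k)) *
          ∑ i ∈ Finset.range (2 * (k + 1)), ∫ y, ‖fderiv ℝ (ξ i) y‖ ^ 2 := by
        refine mul_le_mul_of_nonneg_left ?_ (by positivity)
        exact Finset.sum_le_sum_of_subset_of_nonneg (Finset.filter_subset _ _)
          fun i _ _ => integral_nonneg fun y => by positivity
      _ ≤ _ := by
        refine mul_le_mul_of_nonneg_left (hξE.trans (le_of_eq ?_)) (by positivity)
        push_cast
        rw [add_comm (k : ℝ) 1]
  obtain ⟨hsn, hs2⟩ := sq_div_pow_identity hn hk hr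
  rw [← hs] at hsn hs2
  -- With `N = 2(1 + k)` the terms contribute 1 and 2, hence 3; together with the 2 in `hsum` this
  -- gives the constant `6 * K ^ 2`.
  have hE : s ^ 2 * r ^ n + s ^ 2 / s ^ n * (2 * (1 + k)) = 3 * (s ^ 2 * r ^ n) := by
    rw [hsn]
    field_simp
    ring
  rw [hE, hs2] at hsum
  rw [← hνU]
  refine le_of_mul_le_mul_left (hsum.trans (le_of_eq ?_)) hk
  ring

end Estimate

end Morse

theorem lemma2p2 (n : ℕ) :
    ∃ C : ℝ, 0 < C ∧
      ∀ (U : Set (EuclideanSpace ℝ (Fin n))) (f : ℝ → ℝ)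
        (u : EuclideanSpace ℝ (Fin n) → ℝ) (k : ℕ),
        IsOpen U → (∀ t, 0 ≤ f t) → Monotone f → ContDiff ℝ 1 f →
        Morse.IsWeakSolution f u U → Morse.MorseIndexLE f u U k →
        (∀ V : Fin (k + 1) → Set (EuclideanSpace ℝ (Fin n)),
            (∀ i, IsOpen (V i)) → (∀ i, V i ⊆ U) →
            (∀ i j, i ≠ j → Disjoint (V i) (V j)) →
            ∃ i, Morse.IsStable f u (V i)) ∧
        (2 ≤ n → ∀ (x : EuclideanSpace ℝ (Fin n)) (r : ℝ), 0 < r →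
            Metric.ball x (2 * r) ⊆ U →
            IntegrableOn (fun y => deriv f (u y)) (Metric.ball x r) ∧
            ∫ y in Metric.ball x r, deriv f (u y) ≤
              C * (1 + (k : ℝ)) ^ (2 / (n : ℝ)) * r ^ ((n : ℝ) - 2)) := by
  by_cases hn : 2 ≤ n
  · obtain ⟨C, hC, h⟩ := Morse.exists_integral_deriv_le hn
    exact ⟨C, hC, fun U f u k _ _ hf _ _ hI =>
      ⟨fun V _ hVU hdisj => hI.exists_isStable hVU hdisj, fun _ => h U f u k hf hI⟩⟩
  -- For `n < 2` the estimate is vacuous, so any positive constant serves.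
  · exact ⟨1, one_pos, fun U f u k _ _ _ _ _ hI =>
      ⟨fun V _ hVU hdisj => hI.exists_isStable hVU hdisj, fun h => absurd h hn⟩⟩
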